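/- For $x,y>0$, $x\neq y$, let $$f(x,y)=\frac{e^{-\frac{x^2+xy+y^2}{4y}}\,(x-y)\,\log\left(\frac{x}{y}\right)\log\left(\log\left(\frac{x}{y}\right)\right)}{\sqrt{x}\;y^{3/2}},$$ where the inner logarithm is the real one and the outer logarithm is the principal branch of the complex logarithm, so that $\log(-r)=\log r+\pi i$ for $r>0$. Then $f$ is absolutely integrable on $(0,\infty)^2$, and $$\int_0^\infty\int_0^\infty f(x,y)\,dx\,dy=\frac{4}{9}\pi^2\left(6+3\pi i+\log\left(\frac{2^{14}\,3^3\,\pi^6}{A^{72}}\right)\right),$$ where $A=\lim_{n\to\infty}\dfrac{\prod_{k=1}^n k^k}{n^{n^2/2+n/2+1/12}\,e^{-n^2/4}}\approx 1.28243$ is Glaisher's constant. -/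

import Mathlib

/-- The sequence `(1¹ 2² ⋯ nⁿ) / (n ^ (n²/2 + n/2 + 1/12) · e ^ (-n²/4))`, whose limit is
Glaisher's constant. -/
noncomputable def glaisherSeq (n : ℕ) : ℝ :=
  (∏ k ∈ Finset.Icc 1 n, (k : ℝ) ^ k) /
    ((n : ℝ) ^ ((n : ℝ) ^ 2 / 2 + (n : ℝ) / 2 + 1 / 12) * Real.exp (-(n : ℝ) ^ 2 / 4))

/-- Glaisher's constant (the Glaisher–Kinkelin constant) `A = 1.28242712…`. -/
noncomputable def glaisherConstant : ℝ :=
  Filter.limUnder Filter.atTop glaisherSeq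

/-- The integrand
`e^{-(x² + x y + y²)/(4 y)} (x - y) log (x / y) log (log (x / y)) / (√x y^{3/2})` for `x, y > 0`.
The inner logarithm is the real one; it is negative for `x < y`, so the outer logarithm is the
principal branch of the complex logarithm, `log (-r) = log r + π i` for `r > 0`. -/
noncomputable def logLogIntegrand (x y : ℝ) : ℂ :=
  ((Real.exp (-((x ^ 2 + x * y + y ^ 2) / (4 * y))) * (x - y) * Real.log (x / y) /
      (Real.sqrt x * y ^ (3 / 2 : ℝ)) : ℝ) : ℂ) *
    Complex.log ((Real.log (x / y) : ℝ) : ℂ)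

/-! Put x = y e^u. The powers of y in the prefactor cancel against the Jacobian, and the integrand
becomes r(u) e^{-r(u) y} g(u), with r = `logLogRate` > 0 and g = `sinhLogIntegrand`. Integrating
over y leaves g(u), and the same computation with norms leaves |g(u)|. Thus integrability of g gives
both absolute integrability and the exchange of integrals, and the double integral equals ∫ g over
ℝ.

Since u · `sinhKernel` u is even and log(-u) = log u + πi for u > 0, folding at 0 gives ∫ g = 16
M'(2) + 8πi M(2), where M is the Mellin transform of `sinhKernel`. Expanding the kernel in powers of
e^{-t/2} (`hasSum_sinhKernel`) makes M an elementary factor times Γ(s)ζ(s) for Re s > 1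
(`mellin_sinhKernel`). Hence M'(2) involves ζ'(2), and Euler's constant cancels between Γ'(2) and
ζ'(2).

The functional equation reduces ζ'(2) to ζ'(-1). Finally ζ'(-1) = 1/12 - log A, because
Euler–Maclaurin approximations converge to ζ locally uniformly near -1 and their derivatives there
are 1/12 minus the logarithms of the sequence defining A. -/

/-! ### Euler–Maclaurin approximation of ζ to the left of Re s = 1 -/

/-- The Euler–Maclaurin approximation of order `N` to the Riemann zeta function. -/
noncomputable def zetaApprox (N : ℕ) (s : ℂ) : ℂ :=
  ∑ k ∈ Finset.Icc 1 N, (k : ℂ) ^ (-s) - (N : ℂ) ^ (1 - s) / (1 - s) - (N : ℂ) ^ (-s) / 2 +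
    s * (N : ℂ) ^ (-s - 1) / 12

theorem hasDerivAt_ofReal_cpow_of_pos (c : ℂ) {x : ℝ} (hx : 0 < x) :
    HasDerivAt (fun y : ℝ => (y : ℂ) ^ c) (c * (x : ℂ) ^ (c - 1)) x := by
  have h : HasDerivAt (fun z : ℂ => z ^ c) (c * (x : ℂ) ^ (c - 1) * 1) (x : ℂ) :=
    (hasDerivAt_id (x : ℂ)).cpow_const (Or.inl (by simpa using hx))
  simpa using h.comp_ofReal

/-- One Euler–Maclaurin step on [N, N+1]: `p`, `p1`, `p2` are B₃/6, B₂/2, B₁ at x - N, each the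
derivative of the one before, so the derivative of `ψ` telescopes to the third-order remainder. For
Re s ≥ -3/2 that remainder is O(N^{-3/2}), which is summable. -/
theorem norm_zetaApprox_succ_sub_le {N : ℕ} (hN : 1 ≤ N) {s : ℂ} (hs : s ≠ 1)
    (hre : -3 / 2 ≤ s.re) :
    ‖zetaApprox (N + 1) s - zetaApprox N s‖ ≤
      ‖s‖ * ‖s + 1‖ * ‖s + 2‖ * (N : ℝ) ^ (-3 / 2 : ℝ) := by
  have hN0 : (1 : ℝ) ≤ N := by exact_mod_cast hN
  have hs' : 1 - s ≠ 0 := sub_ne_zero.mpr (Ne.symm hs)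
  set p : ℝ → ℂ := fun x => (((x - N) ^ 3 - 3 / 2 * (x - N) ^ 2 + (x - N) / 2) / 6 : ℝ) with hp
  set p1 : ℝ → ℂ := fun x => ((3 * (x - N) ^ 2 - 3 * (x - N) + 1 / 2) / 6 : ℝ) with hp1
  set p2 : ℝ → ℂ := fun x => ((x - N) - 1 / 2 : ℝ) with hp2
  have dp : ∀ x, HasDerivAt p (p1 x) x := fun x => by
    apply HasDerivAt.ofReal_comp
    have h := (hasDerivAt_id x).sub_const (N : ℝ)
    convert! (((h.pow 3).sub ((h.pow 2).const_mul (3 / 2))).add (h.div_const 2)).div_const 6 using 1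
    simp; ring
  have dp1 : ∀ x, HasDerivAt p1 (p2 x) x := fun x => by
    apply HasDerivAt.ofReal_comp
    have h := (hasDerivAt_id x).sub_const (N : ℝ)
    convert! ((((h.pow 2).const_mul 3).sub (h.const_mul 3)).add_const (1 / 2)).div_const 6 using 1
    simp; ring
  have dp2 : ∀ x, HasDerivAt p2 1 x := fun x => by
    have h := ((hasDerivAt_id x).sub_const (N : ℝ)).sub_const (1 / 2)
    exact_mod_cast h.ofReal_comp
  set ψ : ℝ → ℂ := fun x => p x * (s * (s + 1) * (x : ℂ) ^ (-s - 2)) +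
    p1 x * (s * (x : ℂ) ^ (-s - 1)) + p2 x * (x : ℂ) ^ (-s) - (x : ℂ) ^ (1 - s) / (1 - s) with hψ
  have dψ : ∀ x ∈ Set.Icc (N : ℝ) (N + 1), HasDerivWithinAt ψ
      (p x * (-(s * (s + 1) * (s + 2)) * (x : ℂ) ^ (-s - 3))) (Set.Icc (N : ℝ) (N + 1)) x := by
    intro x hx
    have hx0 : 0 < x := by linarith [hx.1]
    have h2 := hasDerivAt_ofReal_cpow_of_pos (-s - 2) hx0
    have h1 := hasDerivAt_ofReal_cpow_of_pos (-s - 1) hx0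
    have h0 := hasDerivAt_ofReal_cpow_of_pos (-s) hx0
    have hg := hasDerivAt_ofReal_cpow_of_pos (1 - s) hx0
    refine HasDerivAt.hasDerivWithinAt ?_
    convert! ((((dp x).mul (h2.const_mul (s * (s + 1)))).add ((dp1 x).mul (h1.const_mul s))).add
      ((dp2 x).mul h0)).sub (hg.div_const (1 - s)) using 1
    rw [show -s - 2 - 1 = -s - 3 by ring, show -s - 1 - 1 = -s - 2 by ring,
      show 1 - s - 1 = -s by ring]
    field_simp
    ring
  have bound : ∀ x ∈ Set.Icc (N : ℝ) (N + 1),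
      ‖p x * (-(s * (s + 1) * (s + 2)) * (x : ℂ) ^ (-s - 3))‖ ≤
      ‖s‖ * ‖s + 1‖ * ‖s + 2‖ * (N : ℝ) ^ (-3 / 2 : ℝ) := by
    intro x hx
    have hx0 : 0 < x := by linarith [hx.1]
    have hpx : ‖p x‖ ≤ 1 := by
      simp only [hp, Complex.norm_real, Real.norm_eq_abs]
      obtain ⟨a, b⟩ := hx
      rw [abs_le]
      set w := x - N with hw
      have hw0 : 0 ≤ w := by linarith
      have hw1 : w ≤ 1 := by linarith
      have e2 : 0 ≤ w ^ 2 := by positivity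
      have e2' : w ^ 2 ≤ 1 := pow_le_one₀ hw0 hw1
      have e3 : 0 ≤ w ^ 3 := by positivity
      have e3' : w ^ 3 ≤ 1 := pow_le_one₀ hw0 hw1
      constructor <;> linarith
    have hxx : ‖(x : ℂ) ^ (-s - 3)‖ ≤ (N : ℝ) ^ (-3 / 2 : ℝ) := by
      rw [Complex.norm_cpow_eq_rpow_re_of_pos hx0]
      calc x ^ (-s - 3).re ≤ x ^ (-3 / 2 : ℝ) := by
            apply Real.rpow_le_rpow_of_exponent_le (by linarith [hx.1])
            simp; linarith
        _ ≤ _ := Real.rpow_le_rpow_of_nonpos (by linarith) hx.1 (by norm_num)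
    rw [norm_mul, norm_mul, norm_neg, norm_mul, norm_mul]
    calc _ ≤ 1 * (‖s‖ * ‖s + 1‖ * ‖s + 2‖ * (N : ℝ) ^ (-3 / 2 : ℝ)) := by gcongr
      _ = _ := one_mul _
  have key := (convex_Icc (N : ℝ) (N + 1)).norm_image_sub_le_of_norm_hasDerivWithin_le dψ bound
    (Set.left_mem_Icc.mpr (by linarith)) (Set.right_mem_Icc.mpr (by linarith))
  -- At both endpoints B₃ = 0 and B₂/2 = 1/12, while B₁ jumps from -1/2 to 1/2; these give the
  -- correction terms of `zetaApprox`.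
  have e : ψ (N + 1) - ψ N = zetaApprox (N + 1) s - zetaApprox N s := by
    simp only [hψ, hp, hp1, hp2, zetaApprox, Finset.sum_Icc_succ_top (Nat.le_add_left 1 N)]
    push_cast
    ring
  rw [e] at key
  simpa using key

theorem tendsto_zetaApprox {s : ℂ} (hs : 1 < s.re) :
    Filter.Tendsto (fun N : ℕ => zetaApprox (N + 1) s) Filter.atTop (nhds (riemannZeta s)) := by
  have hz : ∀ c : ℂ, c.re < 0 →
      Filter.Tendsto (fun N : ℕ => ((N + 1 : ℕ) : ℂ) ^ c) Filter.atTop (nhds 0) := by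
    intro c hc
    rw [tendsto_zero_iff_norm_tendsto_zero]
    have h := ((tendsto_rpow_neg_atTop (neg_pos.mpr hc)).comp
      tendsto_natCast_atTop_atTop).comp (Filter.tendsto_add_atTop_nat 1)
    refine h.congr fun N => ?_
    rw [Complex.norm_natCast_cpow_of_pos (Nat.succ_pos N)]
    simp
  have hsum : Filter.Tendsto (fun N : ℕ => ∑ k ∈ Finset.Icc 1 (N + 1), (k : ℂ) ^ (-s))
      Filter.atTop (nhds (riemannZeta s)) := by
    have h1 : Summable fun n : ℕ => 1 / ((n : ℂ) + 1) ^ s := by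
      have := (Complex.summable_one_div_nat_cpow (p := s)).mpr hs
      exact_mod_cast (summable_nat_add_iff 1).mpr this
    have h2 := (h1.hasSum.tendsto_sum_nat).comp (Filter.tendsto_add_atTop_nat 1)
    rw [← zeta_eq_tsum_one_div_nat_add_one_cpow hs] at h2
    refine h2.congr fun N => ?_
    have := Finset.sum_Ico_add' (fun k : ℕ => 1 / (k : ℂ) ^ s) 0 (N + 1) 1
    rw [Function.comp, Finset.range_eq_Ico]
    push_cast at this
    rw [this]
    simp only [Complex.cpow_neg, one_div]
    rfl
  have h := ((hsum.sub ((hz (1 - s) (by simp; linarith)).div_const (1 - s))).sub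
    ((hz (-s) (by simp; linarith)).div_const 2)).add
      (((hz (-s - 1) (by simp; linarith)).const_mul s).div_const 12)
  simpa [zetaApprox] using h

/-- A convex open region of the plane containing `-1` and points with real part larger than `1`,
but not `1` itself. -/
def zetaRegion : Set ℂ :=
  {s | -3 / 2 < s.re} ∩ {s | s.re < 3} ∩ {s | s.im < 4} ∩ {s | s.re - s.im < 1}

theorem isOpen_zetaRegion : IsOpen zetaRegion := by
  refine ((IsOpen.inter ?_ ?_).inter ?_).inter ?_ <;>
  exact isOpen_lt (by fun_prop) (by fun_prop)

theorem convex_zetaRegion : Convex ℝ zetaRegion := by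
  intro x hx y hy a b ha hb hab
  obtain ⟨⟨⟨h1, h2⟩, h3⟩, h4⟩ := hx
  obtain ⟨⟨⟨k1, k2⟩, k3⟩, k4⟩ := hy
  simp only [Set.mem_ofPred_eq] at h1 h2 h3 h4 k1 k2 k3 k4
  have hb' : b = 1 - a := by linarith
  rcases ha.eq_or_lt with rfl | ha'
  · have : b = 1 := by linarith
    subst this
    simpa [zetaRegion] using ⟨⟨⟨k1, k2⟩, k3⟩, k4⟩
  · refine ⟨⟨⟨?_, ?_⟩, ?_⟩, ?_⟩ <;>
    simp only [Set.mem_ofPred_eq, Complex.add_re, Complex.add_im, Complex.real_smul,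
      Complex.re_ofReal_mul, Complex.im_ofReal_mul] <;>
    nlinarith

theorem ne_one_of_mem_zetaRegion {s : ℂ} (hs : s ∈ zetaRegion) : s ≠ 1 := by
  rintro rfl
  have := hs.2
  simp at this

theorem differentiableOn_zetaApprox (N : ℕ) :
    DifferentiableOn ℂ (zetaApprox (N + 1)) zetaRegion := by
  intro s hs
  have hs' : 1 - s ≠ 0 := sub_ne_zero.mpr (Ne.symm (ne_one_of_mem_zetaRegion hs))
  have hN : ((N + 1 : ℕ) : ℂ) ≠ 0 := by exact_mod_cast Nat.succ_ne_zero N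
  apply DifferentiableAt.differentiableWithinAt
  have hd : ∀ k : ℕ, k ≠ 0 → ∀ f : ℂ → ℂ, DifferentiableAt ℂ f s →
      DifferentiableAt ℂ (fun s => (k : ℂ) ^ (f s)) s := fun k hk f hf =>
    hf.const_cpow (Or.inl (by exact_mod_cast hk))
  refine (((DifferentiableAt.fun_sum fun k hk => hd k ?_ _ (by fun_prop)).sub
    ((hd (N + 1) (Nat.succ_ne_zero N) _ (by fun_prop)).div (by fun_prop) hs')).sub
    ((hd (N + 1) (Nat.succ_ne_zero N) _ (by fun_prop)).div_const 2)).add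
    ((differentiableAt_id.mul (hd (N + 1) (Nat.succ_ne_zero N) _ (by fun_prop))).div_const 12)
  have := (Finset.mem_Icc.mp hk).1
  omega

/-- The increments are dominated by a summable sequence, so the limit is holomorphic on the region.
It agrees with ζ where Re s > 1, hence everywhere on the region by the identity theorem. -/
theorem tendstoLocallyUniformlyOn_zetaApprox :
    TendstoLocallyUniformlyOn (fun N : ℕ => zetaApprox (N + 1)) riemannZeta Filter.atTop
      zetaRegion := by
  set f : ℕ → ℂ → ℂ := fun n s => zetaApprox (n + 2) s - zetaApprox (n + 1) s with hf
  -- 504 = 7 · 8 · 9 bounds ‖s‖ ‖s + 1‖ ‖s + 2‖ on the region.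
  set u : ℕ → ℝ := fun n => 504 * ((n + 1 : ℕ) : ℝ) ^ (-3 / 2 : ℝ) with hu
  have hus : Summable u := by
    apply Summable.mul_left
    exact (summable_nat_add_iff 1).mpr
      (Real.summable_nat_rpow (p := (-3 / 2 : ℝ)) |>.mpr (by norm_num))
  have hfu : ∀ n s, s ∈ zetaRegion → ‖f n s‖ ≤ u n := by
    intro n s hs
    obtain ⟨⟨⟨h1, h2⟩, h3⟩, h4⟩ := id hs
    simp only [Set.mem_ofPred_eq] at h1 h2 h3 h4
    have key := norm_zetaApprox_succ_sub_le (Nat.succ_le_succ (Nat.zero_le n))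
      (ne_one_of_mem_zetaRegion hs) h1.le
    have hn : ‖s‖ ≤ 7 := (Complex.norm_le_abs_re_add_abs_im s).trans (by
      have : |s.re| ≤ 3 := abs_le.mpr ⟨by linarith, h2.le⟩
      have : |s.im| ≤ 4 := abs_le.mpr ⟨by linarith, h3.le⟩
      linarith)
    have hn1 : ‖s + 1‖ ≤ 8 := (norm_add_le _ _).trans (by norm_num; linarith)
    have hn2 : ‖s + 2‖ ≤ 9 := (norm_add_le _ _).trans (by norm_num; linarith)
    refine key.trans ?_
    calc _ ≤ 7 * 8 * 9 * ((n + 1 : ℕ) : ℝ) ^ (-3 / 2 : ℝ) := by gcongr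
      _ = _ := by simp only [hu]; norm_num
  have hlim := (tendstoUniformlyOn_tsum_nat hus hfu).tendstoLocallyUniformlyOn
  set g : ℂ → ℂ := fun s => zetaApprox 1 s + ∑' n, f n s with hg
  have hlim' : TendstoLocallyUniformlyOn (fun N : ℕ => zetaApprox (N + 1)) g Filter.atTop
      zetaRegion := by
    have h1 : TendstoLocallyUniformlyOn (fun _ : ℕ => zetaApprox 1) (zetaApprox 1) Filter.atTop
        zetaRegion := by
      apply TendstoUniformlyOn.tendstoLocallyUniformlyOn
      intro v hv
      exact Filter.Eventually.of_forall fun _ _ _ => refl_mem_uniformity hv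
    refine (h1.add hlim).congr fun N s _ => ?_
    have := Finset.sum_range_sub (fun n => zetaApprox (n + 1) s) N
    simp only [Pi.add_apply, hf]
    rw [this]
    simp
  have hgd : DifferentiableOn ℂ g zetaRegion := hlim'.differentiableOn
    (Filter.Eventually.of_forall differentiableOn_zetaApprox) isOpen_zetaRegion
  have hzd : DifferentiableOn ℂ riemannZeta zetaRegion := fun s hs =>
    (differentiableAt_riemannZeta (ne_one_of_mem_zetaRegion hs)).differentiableWithinAt
  have hmem : (⟨2, 3⟩ : ℂ) ∈ zetaRegion := by
    refine ⟨⟨⟨?_, ?_⟩, ?_⟩, ?_⟩ <;> simp only [Set.mem_ofPred_eq] <;> norm_num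
  have heq : Set.EqOn g riemannZeta zetaRegion := by
    refine (hgd.analyticOnNhd isOpen_zetaRegion).eqOn_of_preconnected_of_eventuallyEq
      (hzd.analyticOnNhd isOpen_zetaRegion) convex_zetaRegion.isPreconnected hmem ?_
    have hopen : IsOpen {s : ℂ | 1 < s.re} := isOpen_lt (by fun_prop) (by fun_prop)
    filter_upwards [isOpen_zetaRegion.mem_nhds hmem, hopen.mem_nhds (by simp : (1:ℝ) < 2)]
      with s hs hs1
    exact tendsto_nhds_unique (hlim'.tendsto_at hs) (tendsto_zetaApprox hs1)
  exact hlim'.congr_right heq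

/-! ### Glaisher's constant and ζ'(-1) -/

theorem log_glaisherSeq {N : ℕ} (hN : 1 ≤ N) :
    Real.log (glaisherSeq N) = ∑ k ∈ Finset.Icc 1 N, (k : ℝ) * Real.log k -
      ((N : ℝ) ^ 2 / 2 + N / 2 + 1 / 12) * Real.log N + (N : ℝ) ^ 2 / 4 := by
  have hN0 : (0 : ℝ) < N := by exact_mod_cast hN
  have hk : ∀ k ∈ Finset.Icc 1 N, (k : ℝ) ^ k ≠ 0 := fun k hk =>
    pow_ne_zero _ (by have := (Finset.mem_Icc.mp hk).1; exact_mod_cast (by omega : k ≠ 0))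
  rw [glaisherSeq, Real.log_div (Finset.prod_ne_zero_iff.mpr hk) (by positivity),
    Real.log_prod hk, Real.log_mul (by positivity) (by positivity), Real.log_exp,
    Real.log_rpow hN0]
  simp only [Real.log_pow]
  ring

theorem glaisherSeq_pos {N : ℕ} (hN : 1 ≤ N) : 0 < glaisherSeq N := by
  have hN0 : (0 : ℝ) < N := by exact_mod_cast hN
  refine div_pos (Finset.prod_pos fun k hk => pow_pos ?_ _) (by positivity)
  have := (Finset.mem_Icc.mp hk).1
  exact_mod_cast this

theorem deriv_zetaApprox_neg_one {N : ℕ} (hN : 1 ≤ N) :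
    deriv (zetaApprox N) (-1) = ((1 / 12 - Real.log (glaisherSeq N) : ℝ) : ℂ) := by
  have hd : ∀ k : ℕ, k ≠ 0 → ∀ (f : ℂ → ℂ) (f' : ℂ), HasDerivAt f f' (-1) →
      HasDerivAt (fun s => (k : ℂ) ^ (f s)) ((k : ℂ) ^ f (-1) * Complex.log k * f') (-1) :=
    fun k hk f f' hf => hf.const_cpow (Or.inl (by exact_mod_cast hk))
  have hN0 : N ≠ 0 := by omega
  have hid := hasDerivAt_id (-1 : ℂ)
  have h := ((((HasDerivAt.fun_sum (u := Finset.Icc 1 N) fun k hk =>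
    hd k (by have := (Finset.mem_Icc.mp hk).1; omega) _ _ hid.neg).sub
    ((hd N hN0 _ _ (hid.const_sub 1)).div (hid.const_sub 1) (by norm_num))).sub
    ((hd N hN0 _ _ hid.neg).div_const 2)).add
    ((hid.mul (hd N hN0 _ _ (hid.neg.sub_const 1))).div_const 12))
  have h' : deriv (zetaApprox N) (-1) = _ := h.deriv
  rw [h', log_glaisherSeq hN]
  have e2 : (N : ℂ) ^ (1 - -1 : ℂ) = (N : ℂ) ^ 2 := by
    rw [show (1 - -1 : ℂ) = (2 : ℕ) by norm_num, Complex.cpow_natCast]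
  simp only [id, neg_neg, Complex.cpow_one, e2, sub_self, Complex.cpow_zero, Pi.neg_apply]
  push_cast
  simp only [← Complex.natCast_log]
  rw [show (1 : ℂ) - -1 = 2 by norm_num]
  rw [← Finset.sum_mul]
  ring

theorem tendsto_log_glaisherSeq :
    Filter.Tendsto (fun N => ((1 / 12 - Real.log (glaisherSeq N) : ℝ) : ℂ)) Filter.atTop
      (nhds (deriv riemannZeta (-1))) := by
  have hmem : (-1 : ℂ) ∈ zetaRegion := by
    refine ⟨⟨⟨?_, ?_⟩, ?_⟩, ?_⟩ <;> simp only [Set.mem_ofPred_eq] <;> norm_num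
  have h := (tendstoLocallyUniformlyOn_zetaApprox.deriv
    (Filter.Eventually.of_forall differentiableOn_zetaApprox) isOpen_zetaRegion).tendsto_at hmem
  rw [← Filter.tendsto_add_atTop_iff_nat 1]
  refine h.congr fun N => ?_
  rw [← deriv_zetaApprox_neg_one (Nat.succ_le_succ (Nat.zero_le N))]
  rfl

/-- Existence of the limit is what gives the `limUnder` in `glaisherConstant` its meaning. -/
theorem tendsto_glaisherSeq :
    Filter.Tendsto glaisherSeq Filter.atTop
      (nhds (Real.exp (1 / 12 - (deriv riemannZeta (-1)).re))) := by
  have h := (Complex.continuous_re.tendsto _).comp tendsto_log_glaisherSeq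
  have h2 := (Real.continuous_exp.tendsto _).comp (h.const_sub (1 / 12))
  refine h2.congr' ?_
  filter_upwards [Filter.eventually_ge_atTop 1] with N hN
  simp [-one_div, Real.exp_log (glaisherSeq_pos hN)]

theorem glaisherConstant_eq :
    glaisherConstant = Real.exp (1 / 12 - (deriv riemannZeta (-1)).re) :=
  tendsto_glaisherSeq.limUnder_eq

theorem glaisherConstant_pos : 0 < glaisherConstant := by
  rw [glaisherConstant_eq]
  positivity

theorem deriv_riemannZeta_neg_one :
    deriv riemannZeta (-1) = ((1 / 12 - Real.log glaisherConstant : ℝ) : ℂ) := by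
  rw [glaisherConstant_eq, Real.log_exp, sub_sub_cancel]
  have h := (Complex.continuous_re.tendsto _).comp tendsto_log_glaisherSeq
  have h2 := (Complex.continuous_ofReal.tendsto _).comp h
  -- A limit of real numbers equals its own real part, so ζ'(-1) is real.
  exact tendsto_nhds_unique tendsto_log_glaisherSeq h2

/-! ### ζ'(2) from the functional equation -/

theorem complexGamma_two : Complex.Gamma 2 = 1 := by
  simp [Complex.Gamma_ofNat_eq_factorial]

/-- Differentiate ζ(1-s) = 2(2π)^{-s} Γ(s) cos(πs/2) ζ(s) at s = 2. The cosine contributes no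
derivative, as sin π = 0, and Γ'(2) = 1 - γ. -/
theorem deriv_riemannZeta_two :
    deriv riemannZeta 2 = ((Real.pi ^ 2 / 6 * (Real.eulerMascheroniConstant +
      Real.log (2 * Real.pi) - 12 * Real.log glaisherConstant) : ℝ) : ℂ) := by
  have hpi : (Real.pi : ℂ) ≠ 0 := by exact_mod_cast Real.pi_ne_zero
  have hid := hasDerivAt_id (2 : ℂ)
  have hζ : HasDerivAt riemannZeta (deriv riemannZeta 2) 2 :=
    (differentiableAt_riemannZeta (by norm_num)).hasDerivAt
  have hζ1 : HasDerivAt riemannZeta (deriv riemannZeta (-1)) (1 - id 2) := by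
    rw [show (1 : ℂ) - id 2 = -1 by norm_num]
    exact (differentiableAt_riemannZeta (by norm_num)).hasDerivAt
  have hΓ := Complex.hasDerivAt_Gamma_nat 1
  norm_num at hΓ
  have hpow : HasDerivAt (fun s : ℂ => (2 * Real.pi : ℂ) ^ (-s))
      ((2 * Real.pi : ℂ) ^ (-2 : ℂ) * Complex.log (2 * Real.pi) * -1) 2 :=
    hid.neg.const_cpow (Or.inl (by simp))
  have hcos : HasDerivAt (fun s : ℂ => Complex.cos (Real.pi * s / 2)) _ 2 :=
    ((hid.const_mul (Real.pi : ℂ)).div_const 2).ccos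
  have hR := (((hpow.const_mul 2).mul hΓ).mul hcos).mul hζ
  have hL := hζ1.comp (2 : ℂ) (hid.const_sub 1)
  have heq : (fun s : ℂ => riemannZeta (1 - s)) =ᶠ[nhds 2] fun s =>
      2 * (2 * Real.pi : ℂ) ^ (-s) * Complex.Gamma s * Complex.cos (Real.pi * s / 2) *
        riemannZeta s := by
    have hopen : IsOpen {s : ℂ | 1 < s.re} := isOpen_lt (by fun_prop) (by fun_prop)
    filter_upwards [hopen.mem_nhds (show (1 : ℝ) < (2 : ℂ).re by simp)] with s hs
    refine riemannZeta_one_sub (fun n hn => ?_) (fun h => ?_)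
    · rw [hn] at hs
      simp only [Complex.neg_re, Complex.natCast_re] at hs
      linarith [(Nat.cast_nonneg n : (0 : ℝ) ≤ n)]
    · simp [h] at hs
  have key := hL.unique (hR.congr_of_eventuallyEq heq)
  have h2 : (2 * Real.pi : ℂ) ^ (-2 : ℂ) = 1 / (4 * (Real.pi : ℂ) ^ 2) := by
    rw [Complex.cpow_neg, show (2 : ℂ) = (2 : ℕ) by norm_num, Complex.cpow_natCast]
    push_cast
    rw [one_div, mul_pow]
    norm_num
  have hlog : Complex.log (2 * Real.pi) = ((Real.log (2 * Real.pi) : ℝ) : ℂ) := by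
    rw [Complex.ofReal_log (by positivity)]
    push_cast
    rfl
  have e : (Real.pi : ℂ) * 2 / 2 = Real.pi := by ring
  simp only [id, Pi.mul_apply, h2, complexGamma_two, hlog, riemannZeta_two, e, Complex.cos_pi, Complex.sin_pi,
    deriv_riemannZeta_neg_one] at key
  push_cast at key ⊢
  field_simp at key ⊢
  linear_combination (1 / 24) * key

/-! ### The kernel and its Mellin transform -/

theorem hasSum_ite_dvd_succ {f : ℕ → ℂ} {d : ℕ} (hd : 0 < d) {S : ℂ}
    (h : HasSum (fun m => f (d * (m + 1))) S) :
    HasSum (fun n => if d ∣ n + 1 then f (n + 1) else 0) S := by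
  have hpos : ∀ m, 1 ≤ d * (m + 1) := fun m => Nat.mul_pos hd (Nat.succ_pos m)
  have hinj : Function.Injective fun m => d * (m + 1) - 1 := by
    intro a b hab
    have h1 : d * (a + 1) = d * (b + 1) := by
      have := hpos a
      have := hpos b
      simp only at hab
      omega
    have := Nat.eq_of_mul_eq_mul_left hd h1
    omega
  rw [← hinj.hasSum_iff]
  · refine h.congr_fun fun m => ?_
    simp [Nat.sub_add_cancel (hpos m)]
  · intro n hn
    refine if_neg fun ⟨m, hm⟩ => hn ⟨m - 1, ?_⟩
    have hm0 : m ≠ 0 := by rintro rfl; simp at hm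
    simp only
    rw [Nat.sub_add_cancel (Nat.one_le_iff_ne_zero.mpr hm0)]
    omega

/-- Coefficients of the expansion of `sinhKernel` in powers of `exp (-t / 2)`. -/
noncomputable def sinhKernelCoeff (n : ℕ) : ℂ :=
  (1 - (if 2 ∣ n + 1 then 1 else 0) - (if 3 ∣ n + 1 then 3 else 0) +
    (if 6 ∣ n + 1 then 3 else 0)) / 2

/-- The period-six coefficients combine indicators of the multiples of 1, 2, 3 and 6. This serves
both for geometric series and for Dirichlet series. -/
theorem hasSum_sinhKernelCoeff_mul {f : ℕ → ℂ} {S : ℕ → ℂ}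
    (h : ∀ d, 0 < d → HasSum (fun m => f (d * (m + 1))) (S d)) :
    HasSum (fun n => sinhKernelCoeff n * f (n + 1)) ((S 1 - S 2 - 3 * S 3 + 3 * S 6) / 2) := by
  have h1 : HasSum (fun m => f (m + 1)) (S 1) := by simpa using h 1 one_pos
  have h2 := hasSum_ite_dvd_succ two_pos (h 2 two_pos)
  have h3 := hasSum_ite_dvd_succ three_pos (h 3 three_pos)
  have h6 := hasSum_ite_dvd_succ (by norm_num) (h 6 (by norm_num))
  refine ((((h1.sub h2).sub (h3.mul_left 3)).add (h6.mul_left 3)).div_const 2).congr_fun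
    fun n => ?_
  simp only [sinhKernelCoeff]
  split_ifs <;> ring

/-- The kernel `sinh (t / 2) / (1 + 2 cosh t)`. -/
noncomputable def sinhKernel (t : ℝ) : ℝ :=
  Real.sinh (t / 2) / (1 + 2 * Real.cosh t)

theorem one_add_two_mul_cosh_pos (t : ℝ) : 0 < 1 + 2 * Real.cosh t := by
  linarith [Real.cosh_pos t]

theorem continuous_sinhKernel : Continuous sinhKernel := by
  unfold sinhKernel
  exact (Real.continuous_sinh.comp (by fun_prop)).div
    (continuous_const.add (Real.continuous_cosh.const_mul 2))
    fun t => (one_add_two_mul_cosh_pos t).ne'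

theorem sinhKernel_neg (t : ℝ) : sinhKernel (-t) = -sinhKernel t := by
  simp only [sinhKernel, neg_div, Real.sinh_neg, Real.cosh_neg]

theorem abs_sinhKernel_le {t : ℝ} (ht : 0 ≤ t) : |sinhKernel t| ≤ Real.exp (-(1 / 2) * t) := by
  have h0 : 0 ≤ Real.sinh (t / 2) := Real.sinh_nonneg_iff.mpr (by linarith)
  rw [sinhKernel, abs_of_nonneg (div_nonneg h0 (one_add_two_mul_cosh_pos t).le),
    div_le_iff₀ (one_add_two_mul_cosh_pos t)]
  calc Real.sinh (t / 2) ≤ Real.exp (t / 2) := by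
        rw [Real.sinh_eq]
        linarith [Real.exp_pos (t / 2), Real.exp_pos (-(t / 2))]
    _ = Real.exp (-(1 / 2) * t) * Real.exp t := by rw [← Real.exp_add]; ring_nf
    _ ≤ _ := by
        gcongr
        rw [Real.cosh_eq]
        linarith [Real.exp_pos (-t)]

theorem hasSum_sinhKernel {t : ℝ} (ht : 0 < t) :
    HasSum (fun n => sinhKernelCoeff n * (Real.exp (-(((n : ℝ) + 1) / 2) * t) : ℂ))
      (sinhKernel t) := by
  set x : ℝ := Real.exp (-(t / 2)) with hx
  have hx0 : 0 < x := Real.exp_pos _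
  have hx1 : x < 1 := by rw [hx, Real.exp_lt_one_iff]; linarith
  have hxd : ∀ d : ℕ, 0 < d → x ^ d < 1 := fun d hd => pow_lt_one₀ hx0.le hx1 hd.ne'
  have hS : ∀ d : ℕ, 0 < d → HasSum (fun m : ℕ => ((x : ℂ)) ^ (d * (m + 1)))
      ((x ^ d / (1 - x ^ d) : ℝ) : ℂ) := by
    intro d hd
    have h := (hasSum_geometric_of_lt_one (by positivity) (hxd d hd)).mul_left (x ^ d)
    rw [← div_eq_mul_inv] at h
    have h' := (Complex.hasSum_ofReal (f := fun m : ℕ => x ^ d * (x ^ d) ^ m)).mpr h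
    refine h'.congr_fun fun m => ?_
    push_cast
    rw [← pow_mul, ← pow_add]
    ring_nf
  have h := hasSum_sinhKernelCoeff_mul (f := fun m => (x : ℂ) ^ m) hS
  -- With x = e^{-t/2} the kernel is x(1 - x²) / (2(x⁴ + x² + 1)), a combination of x^d/(1 - x^d)
  -- for d = 1, 2, 3, 6.
  have hval : sinhKernel t = (x ^ 1 / (1 - x ^ 1) - x ^ 2 / (1 - x ^ 2) -
      3 * (x ^ 3 / (1 - x ^ 3)) + 3 * (x ^ 6 / (1 - x ^ 6))) / 2 := by
    have e1 : Real.exp (t / 2) = x⁻¹ := by rw [hx, ← Real.exp_neg, neg_neg]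
    have e2 : Real.exp (-t) = x ^ 2 := by rw [hx, ← Real.exp_nat_mul]; congr 1; push_cast; ring
    have e3 : Real.exp t = (x ^ 2)⁻¹ := by rw [← e2, ← Real.exp_neg, neg_neg]
    rw [sinhKernel, Real.sinh_eq, Real.cosh_eq, e1, e2, e3, ← hx]
    have n1 : 1 - x ≠ 0 := by linarith
    have n2 : 1 - x ^ 2 ≠ 0 := by linarith [hxd 2 (by norm_num)]
    have n3 : 1 - x ^ 3 ≠ 0 := by linarith [hxd 3 (by norm_num)]
    have n6 : 1 - x ^ 6 ≠ 0 := by linarith [hxd 6 (by norm_num)]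
    have n4 : x ^ 2 + 1 + x ^ 4 ≠ 0 := by positivity
    have lhs : (x⁻¹ - x) / 2 / (1 + 2 * (((x ^ 2)⁻¹ + x ^ 2) / 2)) =
        x * (1 - x ^ 2) / (2 * (x ^ 2 + 1 + x ^ 4)) := by
      field_simp
      ring
    rw [lhs]
    rw [pow_one]
    field_simp
    ring
  rw [hval]
  convert! h using 1
  · ext n
    rw [← Complex.ofReal_pow, hx, ← Real.exp_nat_mul]
    congr 3
    push_cast
    ring
  · push_cast
    ring

theorem mellin_sinhKernel {s : ℂ} (hs : 1 < s.re) :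
    mellin (fun t => (sinhKernel t : ℂ)) s = Complex.Gamma s * riemannZeta s *
      ((2 : ℂ) ^ s - 1 - 3 * (3 / 2 : ℂ) ^ (-s) + 3 * (3 : ℂ) ^ (-s)) / 2 := by
  have hcoeff : ∀ n, ‖sinhKernelCoeff n‖ ≤ 4 := by
    intro n
    simp only [sinhKernelCoeff]
    split_ifs <;> norm_num
  have hsum : Summable fun n : ℕ => ‖sinhKernelCoeff n‖ / (((n : ℝ) + 1) / 2) ^ s.re := by
    have h1 : Summable fun n : ℕ => 4 * (2 : ℝ) ^ s.re * (1 / ((n + 1 : ℕ) : ℝ) ^ s.re) :=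
      ((summable_nat_add_iff 1).mpr (Real.summable_one_div_nat_rpow.mpr hs)).mul_left _
    refine h1.of_nonneg_of_le (fun n => by positivity) fun n => ?_
    rw [Real.div_rpow (by positivity) (by norm_num)]
    push_cast
    rw [div_div_eq_mul_div, mul_one_div]
    gcongr
    exact hcoeff n
  have h := hasSum_mellin (p := fun n : ℕ => ((n : ℝ) + 1) / 2) (F := fun t => (sinhKernel t : ℂ))
    (fun n => Or.inr (by positivity)) (by linarith : 0 < s.re)
    (fun t ht => hasSum_sinhKernel ht) hsum
  have hS : ∀ d : ℕ, 0 < d → HasSum (fun m : ℕ => (((d * (m + 1) : ℕ) : ℝ) / 2 : ℂ) ^ (-s))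
      ((d / 2 : ℂ) ^ (-s) * riemannZeta s) := by
    intro d hd
    have h1 : Summable fun n : ℕ => 1 / ((n : ℂ) + 1) ^ s := by
      have := (Complex.summable_one_div_nat_cpow (p := s)).mpr hs
      exact_mod_cast (summable_nat_add_iff 1).mpr this
    have h2 := h1.hasSum.mul_left ((d / 2 : ℂ) ^ (-s))
    rw [← zeta_eq_tsum_one_div_nat_add_one_cpow hs] at h2
    refine h2.congr_fun fun m => ?_
    have := Complex.mul_cpow_ofReal_nonneg (a := (d : ℝ) / 2) (b := (m : ℝ) + 1) (by positivity)
      (by positivity) (-s)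
    push_cast at this ⊢
    rw [one_div, ← Complex.cpow_neg, ← this]
    ring_nf
  have h3 := (hasSum_sinhKernelCoeff_mul (f := fun m : ℕ => (((m : ℝ) / 2 : ℂ)) ^ (-s))
    hS).mul_left (Complex.Gamma s)
  have h4 := h.unique (h3.congr_fun fun n => by
    rw [Complex.cpow_neg]
    push_cast
    ring)
  rw [h4]
  have e1 : ((1 : ℕ) / 2 : ℂ) ^ (-s) = 2 ^ s := by
    rw [Nat.cast_one, one_div, Complex.cpow_neg, Complex.inv_cpow, inv_inv]
    rw [show (2 : ℂ) = ((2 : ℝ) : ℂ) by norm_num, Complex.arg_ofReal_of_nonneg (by norm_num)]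
    exact Real.pi_pos.ne
  rw [e1]
  norm_num
  ring

theorem locallyIntegrableOn_sinhKernel :
    MeasureTheory.LocallyIntegrableOn (fun t => (sinhKernel t : ℂ)) (Set.Ioi 0) :=
  (Complex.continuous_ofReal.comp continuous_sinhKernel).locallyIntegrable.locallyIntegrableOn _

theorem sinhKernel_isBigO_atTop :
    (fun t => (sinhKernel t : ℂ)) =O[Filter.atTop] fun t => Real.exp (-(1 / 2) * t) := by
  refine Asymptotics.IsBigO.of_bound 1 ?_
  filter_upwards [Filter.eventually_ge_atTop 0] with t ht
  rw [Complex.norm_real, Real.norm_eq_abs, one_mul, Real.norm_eq_abs, Real.abs_exp]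
  exact abs_sinhKernel_le ht

theorem sinhKernel_isBigO_zero :
    (fun t => (sinhKernel t : ℂ)) =O[nhdsWithin 0 (Set.Ioi 0)] fun t => t ^ (-(0 : ℝ)) := by
  refine Asymptotics.IsBigO.of_bound 1 ?_
  filter_upwards [self_mem_nhdsWithin] with t ht
  have ht' : (0 : ℝ) < t := ht
  rw [Complex.norm_real, Real.norm_eq_abs]
  refine (abs_sinhKernel_le ht'.le).trans ?_
  simp only [neg_zero, Real.rpow_zero, norm_one, mul_one, Real.exp_le_one_iff]
  linarith

/-- The kernel is bounded near 0 and decays exponentially, so 2 lies inside the strip 0 < Re s < 3,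
where the Mellin transform may be differentiated under the integral. -/
theorem hasMellin_log_sinhKernel :
    MellinConvergent (fun t => Real.log t • (sinhKernel t : ℂ)) 2 ∧
      HasDerivAt (mellin fun t => (sinhKernel t : ℂ))
        (mellin (fun t => Real.log t • (sinhKernel t : ℂ)) 2) 2 :=
  mellin_hasDerivAt_of_isBigO_rpow (a := 3) locallyIntegrableOn_sinhKernel
    (sinhKernel_isBigO_atTop.trans
      (isLittleO_exp_neg_mul_rpow_atTop (a := 1 / 2) (by norm_num) (-3)).isBigO)
    (by norm_num) sinhKernel_isBigO_zero (by norm_num)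

theorem mellinConvergent_sinhKernel_two :
    MellinConvergent (fun t => (sinhKernel t : ℂ)) 2 :=
  mellinConvergent_of_isBigO_rpow_exp (a := 1 / 2) (by norm_num) locallyIntegrableOn_sinhKernel
    sinhKernel_isBigO_atTop sinhKernel_isBigO_zero (by norm_num)

theorem mellin_sinhKernel_two :
    mellin (fun t => (sinhKernel t : ℂ)) 2 = (Real.pi : ℂ) ^ 2 / 6 := by
  rw [mellin_sinhKernel (by norm_num), complexGamma_two, riemannZeta_two, Complex.cpow_neg, Complex.cpow_neg]
  simp only [Complex.cpow_ofNat]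
  norm_num

theorem mellin_log_sinhKernel_two :
    mellin (fun t => Real.log t • (sinhKernel t : ℂ)) 2 = (Real.pi : ℂ) ^ 2 / 36 *
      (6 + ((Real.log (2 ^ 14 * 3 ^ 3 * Real.pi ^ 6 / glaisherConstant ^ 72) : ℝ) : ℂ)) := by
  have hid := hasDerivAt_id (2 : ℂ)
  have hζ : HasDerivAt riemannZeta (deriv riemannZeta 2) 2 :=
    (differentiableAt_riemannZeta (by norm_num)).hasDerivAt
  have hΓ := Complex.hasDerivAt_Gamma_nat 1
  norm_num at hΓ
  have h2 := hid.const_cpow (c := (2 : ℂ)) (Or.inl (by norm_num))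
  have h32 := hid.neg.const_cpow (c := (3 / 2 : ℂ)) (Or.inl (by norm_num))
  have h3 := hid.neg.const_cpow (c := (3 : ℂ)) (Or.inl (by norm_num))
  have hR := ((hΓ.mul hζ).mul
    (((h2.sub_const 1).sub (h32.const_mul 3)).add (h3.const_mul 3))).div_const 2
  have heq : (mellin fun t => (sinhKernel t : ℂ)) =ᶠ[nhds 2] fun s =>
      Complex.Gamma s * riemannZeta s *
        ((2 : ℂ) ^ s - 1 - 3 * (3 / 2 : ℂ) ^ (-s) + 3 * (3 : ℂ) ^ (-s)) / 2 := by
    have hopen : IsOpen {s : ℂ | 1 < s.re} := isOpen_lt (by fun_prop) (by fun_prop)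
    filter_upwards [hopen.mem_nhds (show (1 : ℝ) < (2 : ℂ).re by simp)] with s hs
    exact mellin_sinhKernel hs
  have key := hasMellin_log_sinhKernel.2.unique (hR.congr_of_eventuallyEq heq)
  rw [key]
  have l2 : Complex.log 2 = ((Real.log 2 : ℝ) : ℂ) := by
    rw [Complex.ofReal_log (by norm_num)]; norm_num
  have l3 : Complex.log 3 = ((Real.log 3 : ℝ) : ℂ) := by
    rw [Complex.ofReal_log (by norm_num)]; norm_num
  have l32 : Complex.log (3 / 2) = ((Real.log 3 - Real.log 2 : ℝ) : ℂ) := by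
    rw [← Real.log_div (by norm_num) (by norm_num), Complex.ofReal_log (by norm_num)]; norm_num
  have hA := glaisherConstant_pos
  have hpi := Real.pi_pos
  have hlog : Real.log (2 ^ 14 * 3 ^ 3 * Real.pi ^ 6 / glaisherConstant ^ 72) =
      14 * Real.log 2 + 3 * Real.log 3 + 6 * Real.log Real.pi -
        72 * Real.log glaisherConstant := by
    rw [Real.log_div (by positivity) (by positivity), Real.log_mul (by positivity) (by positivity),
      Real.log_mul (by positivity) (by positivity)]
    simp only [Real.log_pow]
    push_cast
    ring
  simp only [id, Pi.neg_apply, Pi.mul_apply, Pi.sub_apply, Pi.add_apply, complexGamma_two, riemannZeta_two, deriv_riemannZeta_two, hlog,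
    l2, l3, l32, Complex.cpow_neg, Complex.cpow_ofNat,
    Real.log_mul (two_ne_zero' ℝ) Real.pi_pos.ne']
  push_cast
  ring

/-! ### The one-variable integral -/

/-- The one-variable integrand `8 u sinh (u / 2) log u / (1 + 2 cosh u)`. -/
noncomputable def sinhLogIntegrand (u : ℝ) : ℂ :=
  ((8 * (u * sinhKernel u) : ℝ) : ℂ) * Complex.log u

theorem sinhLogIntegrand_of_pos {u : ℝ} (hu : 0 < u) :
    sinhLogIntegrand u =
      8 * ((u : ℂ) ^ (2 - 1 : ℂ) • (Real.log u • (sinhKernel u : ℂ))) := by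
  rw [sinhLogIntegrand, ← Complex.ofReal_log hu.le, show (2 - 1 : ℂ) = 1 by norm_num,
    Complex.cpow_one]
  simp only [Complex.real_smul, smul_eq_mul]
  push_cast
  ring

theorem sinhLogIntegrand_neg_of_pos {u : ℝ} (hu : 0 < u) :
    sinhLogIntegrand (-u) =
      8 * ((u : ℂ) ^ (2 - 1 : ℂ) • (Real.log u • (sinhKernel u : ℂ))) +
        8 * Real.pi * Complex.I * ((u : ℂ) ^ (2 - 1 : ℂ) • (sinhKernel u : ℂ)) := by
  have hlog : Complex.log ((-u : ℝ) : ℂ) = Real.log u + Real.pi * Complex.I := by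
    rw [Complex.log, Complex.arg_ofReal_of_neg (by linarith), Complex.norm_real, norm_neg,
      Real.norm_of_nonneg hu.le]
  rw [sinhLogIntegrand, hlog, sinhKernel_neg, show (2 - 1 : ℂ) = 1 by norm_num,
    Complex.cpow_one]
  simp only [Complex.real_smul, smul_eq_mul]
  push_cast
  ring

theorem integrableOn_sinhLogIntegrand_Ioi :
    MeasureTheory.IntegrableOn sinhLogIntegrand (Set.Ioi 0) := by
  have h : MeasureTheory.IntegrableOn _ _ _ := hasMellin_log_sinhKernel.1
  exact MeasureTheory.IntegrableOn.congr_fun (h.const_mul 8) (fun u hu => (sinhLogIntegrand_of_pos hu).symm)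
    measurableSet_Ioi

theorem integrableOn_sinhLogIntegrand_neg_Ioi :
    MeasureTheory.IntegrableOn (fun u => sinhLogIntegrand (-u)) (Set.Ioi 0) := by
  have h : MeasureTheory.IntegrableOn _ _ _ := hasMellin_log_sinhKernel.1
  have h' : MeasureTheory.IntegrableOn _ _ _ := mellinConvergent_sinhKernel_two
  exact MeasureTheory.IntegrableOn.congr_fun
    ((h.const_mul 8).add (h'.const_mul (8 * Real.pi * Complex.I)))
    (fun u hu => (sinhLogIntegrand_neg_of_pos hu).symm) measurableSet_Ioi

theorem integrableOn_sinhLogIntegrand_Iic :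
    MeasureTheory.IntegrableOn sinhLogIntegrand (Set.Iic 0) := by
  rw [integrableOn_Iic_iff_integrableOn_Iio]
  have h := integrableOn_sinhLogIntegrand_neg_Ioi
  rw [← (MeasureTheory.Measure.measurePreserving_neg MeasureTheory.volume).integrableOn_comp_preimage
    (Homeomorph.neg ℝ).measurableEmbedding]
  convert! h using 1
  simp

theorem integrable_sinhLogIntegrand : MeasureTheory.Integrable sinhLogIntegrand := by
  rw [← MeasureTheory.integrableOn_univ, ← Set.Iic_union_Ioi (a := (0 : ℝ))]
  exact integrableOn_sinhLogIntegrand_Iic.union integrableOn_sinhLogIntegrand_Ioi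

theorem integral_sinhLogIntegrand :
    ∫ u, sinhLogIntegrand u = 4 / 9 * (Real.pi : ℂ) ^ 2 *
      (6 + 3 * (Real.pi : ℂ) * Complex.I +
        ((Real.log (2 ^ 14 * 3 ^ 3 * Real.pi ^ 6 / glaisherConstant ^ 72) : ℝ) : ℂ)) := by
  have h : MeasureTheory.IntegrableOn _ _ _ := hasMellin_log_sinhKernel.1
  have h' : MeasureTheory.IntegrableOn _ _ _ := mellinConvergent_sinhKernel_two
  have hIic := integral_comp_neg_Ioi 0 sinhLogIntegrand
  rw [neg_zero] at hIic
  have e1 : ∫ u in Set.Ioi (0 : ℝ), sinhLogIntegrand u =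
      8 * mellin (fun t => Real.log t • (sinhKernel t : ℂ)) 2 := by
    rw [mellin, ← MeasureTheory.integral_const_mul]
    exact MeasureTheory.setIntegral_congr_fun measurableSet_Ioi fun u hu =>
      sinhLogIntegrand_of_pos hu
  have e2 : ∫ u in Set.Ioi (0 : ℝ), sinhLogIntegrand (-u) =
      8 * mellin (fun t => Real.log t • (sinhKernel t : ℂ)) 2 +
        8 * Real.pi * Complex.I * mellin (fun t => (sinhKernel t : ℂ)) 2 := by
    rw [mellin, mellin, ← MeasureTheory.integral_const_mul, ← MeasureTheory.integral_const_mul,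
      ← MeasureTheory.integral_add (h.const_mul 8) (h'.const_mul _)]
    exact MeasureTheory.setIntegral_congr_fun measurableSet_Ioi fun u hu =>
      sinhLogIntegrand_neg_of_pos hu
  rw [← intervalIntegral.integral_Iic_add_Ioi integrableOn_sinhLogIntegrand_Iic
    integrableOn_sinhLogIntegrand_Ioi, ← hIic, e1, e2, mellin_log_sinhKernel_two,
    mellin_sinhKernel_two]
  ring

/-! ### Change of variables and Fubini -/

/-- The exponential rate `(e ^ (2 u) + e ^ u + 1) / 4` of the integrand in the coordinates
`x = y e ^ u`, `y`. -/
noncomputable def logLogRate (u : ℝ) : ℝ :=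
  Real.exp u * (1 + 2 * Real.cosh u) / 4

theorem logLogRate_pos (u : ℝ) : 0 < logLogRate u :=
  div_pos (mul_pos (Real.exp_pos u) (one_add_two_mul_cosh_pos u)) (by norm_num)

/-- The integrand in the coordinates `x = y e ^ u`, `y`. -/
noncomputable def expLogIntegrand (u y : ℝ) : ℂ :=
  (Real.exp (-logLogRate u * y) : ℂ) * (logLogRate u * sinhLogIntegrand u)

theorem smul_logLogIntegrand (u : ℝ) {y : ℝ} (hy : 0 < y) :
    (y * Real.exp u) • logLogIntegrand (y * Real.exp u) y = expLogIntegrand u y := by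
  have hlog : Real.log (y * Real.exp u / y) = u := by
    rw [mul_div_cancel_left₀ _ hy.ne', Real.log_exp]
  rw [logLogIntegrand, expLogIntegrand, sinhLogIntegrand, hlog, Complex.real_smul, ← mul_assoc,
    ← mul_assoc, ← mul_assoc, ← Complex.ofReal_mul, ← Complex.ofReal_mul, ← Complex.ofReal_mul]
  congr 2
  -- In terms of e^{u/2} the square root and the hyperbolic functions all become rational.
  set z := Real.exp (u / 2) with hz
  have hz0 : 0 < z := Real.exp_pos _
  have e1 : Real.exp u = z ^ 2 := by rw [hz, ← Real.exp_nat_mul]; congr 1; push_cast; ring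
  have e2 : Real.exp (-u) = (z ^ 2)⁻¹ := by rw [Real.exp_neg, e1]
  have e3 : Real.exp (-(u / 2)) = z⁻¹ := by rw [hz, Real.exp_neg]
  have hrate : logLogRate u = (z ^ 4 + z ^ 2 + 1) / 4 := by
    rw [logLogRate, Real.cosh_eq, e1, e2]
    field_simp
    ring
  have hq : logLogRate u * (8 * (u * sinhKernel u)) = u * (z ^ 2 - 1) * z := by
    have := (one_add_two_mul_cosh_pos u).ne'
    rw [logLogRate, sinhKernel]
    calc _ = 2 * Real.exp u * u * Real.sinh (u / 2) := by field_simp; ring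
      _ = _ := by rw [e1, Real.sinh_eq, e3, ← hz]; field_simp
  have hs : Real.sqrt (y * z ^ 2) * y ^ (3 / 2 : ℝ) = z * y ^ 2 := by
    rw [Real.sqrt_mul hy.le, Real.sqrt_sq hz0.le, Real.sqrt_eq_rpow, mul_right_comm,
      ← Real.rpow_add hy]
    norm_num
    ring
  rw [mul_assoc (Real.exp (-logLogRate u * y)), hq, hrate, e1, hs]
  have he : -(((y * z ^ 2) ^ 2 + y * z ^ 2 * y + y ^ 2) / (4 * y)) =
      -((z ^ 4 + z ^ 2 + 1) / 4) * y := by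
    field_simp
  rw [he]
  field_simp

theorem image_mul_exp_univ {y : ℝ} (hy : 0 < y) :
    (fun u => y * Real.exp u) '' Set.univ = Set.Ioi 0 := by
  ext x
  simp only [Set.image_univ, Set.mem_range, Set.mem_Ioi]
  constructor
  · rintro ⟨u, rfl⟩
    positivity
  · intro hx
    exact ⟨Real.log (x / y), by rw [Real.exp_log (by positivity)]; field_simp⟩

section ChangeOfVariables

variable {E : Type*} [NormedAddCommGroup E] [NormedSpace ℝ E]

theorem integrableOn_Ioi_iff_mul_exp {y : ℝ} (hy : 0 < y) (g : ℝ → E) :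
    MeasureTheory.IntegrableOn g (Set.Ioi 0) ↔
      MeasureTheory.Integrable fun u => (y * Real.exp u) • g (y * Real.exp u) := by
  rw [← image_mul_exp_univ hy, MeasureTheory.integrableOn_image_iff_integrableOn_abs_deriv_smul
    MeasurableSet.univ (fun u _ => ((Real.hasDerivAt_exp u).const_mul y).hasDerivWithinAt)
    (fun a _ b _ hab => Real.exp_injective (mul_left_cancel₀ hy.ne' hab)),
    MeasureTheory.integrableOn_univ]
  simp only [abs_of_pos (mul_pos hy (Real.exp_pos _))]

theorem integral_Ioi_eq_integral_mul_exp {y : ℝ} (hy : 0 < y) (g : ℝ → E) :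
    ∫ x in Set.Ioi 0, g x = ∫ u, (y * Real.exp u) • g (y * Real.exp u) := by
  rw [← image_mul_exp_univ hy, MeasureTheory.integral_image_eq_integral_abs_deriv_smul
    MeasurableSet.univ (fun u _ => ((Real.hasDerivAt_exp u).const_mul y).hasDerivWithinAt)
    (fun a _ b _ hab => Real.exp_injective (mul_left_cancel₀ hy.ne' hab)),
    MeasureTheory.setIntegral_univ]
  simp only [abs_of_pos (mul_pos hy (Real.exp_pos _))]

end ChangeOfVariables

theorem measurable_sinhLogIntegrand : Measurable sinhLogIntegrand := by
  have := continuous_sinhKernel.measurable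
  unfold sinhLogIntegrand
  fun_prop

theorem measurable_logLogIntegrand :
    Measurable fun z : ℝ × ℝ => logLogIntegrand z.1 z.2 := by
  unfold logLogIntegrand
  fun_prop

theorem integral_exp_neg_mul_Ioi_zero {a : ℝ} (ha : 0 < a) :
    ∫ y in Set.Ioi (0 : ℝ), Real.exp (-a * y) = a⁻¹ := by
  rw [integral_exp_mul_Ioi (by linarith)]
  simp [neg_div_neg_eq]

theorem integral_expLogIntegrand (u : ℝ) :
    ∫ y in Set.Ioi (0 : ℝ), expLogIntegrand u y = sinhLogIntegrand u := by
  have h0 : (logLogRate u : ℂ) ≠ 0 := by exact_mod_cast (logLogRate_pos u).ne'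
  simp only [expLogIntegrand]
  rw [MeasureTheory.integral_mul_const, integral_complex_ofReal,
    integral_exp_neg_mul_Ioi_zero (logLogRate_pos u), Complex.ofReal_inv,
    inv_mul_cancel_left₀ h0]

theorem integral_norm_expLogIntegrand (u : ℝ) :
    ∫ y in Set.Ioi (0 : ℝ), ‖expLogIntegrand u y‖ = ‖sinhLogIntegrand u‖ := by
  simp only [expLogIntegrand, norm_mul, Complex.norm_real, Real.norm_eq_abs, Real.abs_exp,
    abs_of_pos (logLogRate_pos u)]
  rw [MeasureTheory.integral_mul_const, integral_exp_neg_mul_Ioi_zero (logLogRate_pos u),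
    inv_mul_cancel_left₀ (logLogRate_pos u).ne']

/-- By Tonelli: each slice in y is a decaying exponential, and its norm integrates to |g(u)|, which
is integrable. -/
theorem integrable_expLogIntegrand :
    MeasureTheory.Integrable (Function.uncurry expLogIntegrand)
      (MeasureTheory.volume.prod (MeasureTheory.volume.restrict (Set.Ioi 0))) := by
  have hmeas : Measurable (Function.uncurry expLogIntegrand) := by
    have h1 := measurable_sinhLogIntegrand
    have h2 : Measurable logLogRate := by
      have := Real.continuous_cosh.measurable
      unfold logLogRate
      fun_prop
    unfold Function.uncurry expLogIntegrand
    fun_prop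
  rw [MeasureTheory.integrable_prod_iff hmeas.aestronglyMeasurable]
  refine ⟨Filter.Eventually.of_forall fun u => ?_, ?_⟩
  · have h : MeasureTheory.Integrable _ _ :=
      integrableOn_exp_mul_Ioi (neg_lt_zero.mpr (logLogRate_pos u)) 0
    exact (h.ofReal (𝕜 := ℂ)).mul_const (logLogRate u * sinhLogIntegrand u)
  · simp only [Function.uncurry_apply_pair, integral_norm_expLogIntegrand]
    exact integrable_sinhLogIntegrand.norm

theorem integrableOn_logLogIntegrand :
    MeasureTheory.IntegrableOn (fun z : ℝ × ℝ => logLogIntegrand z.1 z.2)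
      (Set.Ioi (0 : ℝ) ×ˢ Set.Ioi (0 : ℝ)) := by
  rw [MeasureTheory.IntegrableOn, MeasureTheory.Measure.volume_eq_prod,
    ← MeasureTheory.Measure.prod_restrict,
    MeasureTheory.integrable_prod_iff' measurable_logLogIntegrand.aestronglyMeasurable]
  constructor
  · filter_upwards [integrable_expLogIntegrand.prod_left_ae,
      MeasureTheory.ae_restrict_mem measurableSet_Ioi] with y hint hy
    have hy' : 0 < y := hy
    refine (integrableOn_Ioi_iff_mul_exp hy' fun x => logLogIntegrand x y).mpr ?_
    simpa only [smul_logLogIntegrand _ hy', Function.uncurry_apply_pair] using hint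
  · refine integrable_expLogIntegrand.integral_norm_prod_right.congr ?_
    filter_upwards [MeasureTheory.ae_restrict_mem measurableSet_Ioi] with y hy
    have hy' : 0 < y := hy
    rw [integral_Ioi_eq_integral_mul_exp hy' fun x => ‖logLogIntegrand x y‖]
    refine MeasureTheory.integral_congr_ae (Filter.Eventually.of_forall fun u => ?_)
    simp only [Function.uncurry_apply_pair, ← smul_logLogIntegrand u hy', norm_smul,
      Real.norm_of_nonneg (mul_pos hy' (Real.exp_pos u)).le, smul_eq_mul]

theorem mainTheorem7 :
    MeasureTheory.IntegrableOn (fun z : ℝ × ℝ => logLogIntegrand z.1 z.2)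
      (Set.Ioi (0 : ℝ) ×ˢ Set.Ioi (0 : ℝ)) ∧
    (∫ y in Set.Ioi (0 : ℝ), (∫ x in Set.Ioi (0 : ℝ), logLogIntegrand x y)) =
      4 / 9 * (Real.pi : ℂ) ^ 2 *
        (6 + 3 * (Real.pi : ℂ) * Complex.I +
          ((Real.log (2 ^ 14 * 3 ^ 3 * Real.pi ^ 6 / glaisherConstant ^ 72) : ℝ) : ℂ)) := by
  refine ⟨integrableOn_logLogIntegrand, ?_⟩
  rw [← integral_sinhLogIntegrand]
  calc _ = ∫ y in Set.Ioi (0 : ℝ), ∫ u, expLogIntegrand u y := by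
        refine MeasureTheory.setIntegral_congr_fun measurableSet_Ioi fun y hy => ?_
        have hy' : 0 < y := hy
        simp only [integral_Ioi_eq_integral_mul_exp hy' fun x => logLogIntegrand x y,
          smul_logLogIntegrand _ hy']
    _ = ∫ u, ∫ y in Set.Ioi (0 : ℝ), expLogIntegrand u y :=
        (MeasureTheory.integral_integral_swap integrable_expLogIntegrand).symm
    _ = _ := by simp only [integral_expLogIntegrand]
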